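/- Let $X$ be a countable set with at least two elements and $(p(x,y))_{x,y\in X}$ an irreducible transition probability on $X$ with $\sup_y\sum_x p(x,y)<\infty$. Let $a:X\to(0,\infty)$ satisfy $\sum_x a_x<\infty$ and, for some constant $K$, $\sum_y p(x,y)a_y+\sum_y a_y p(y,x)\le K a_x$ for all $x$. Let $\mathfrak X=\{\eta\in\mathbb N^X:\sum_x\eta(x)a_x<\infty\}$, with the coordinatewise partial order and the distance $\|\eta-\zeta\|=\sum_x|\eta(x)-\zeta(x)|a_x$. Let $g^k_{\alpha,\beta}\ge 0$ ($k,\alpha,\beta\in\mathbb N$) be rates with $g^0_{\alpha,\beta}=0$, $g^k_{\alpha,\beta}=0$ for $k>\alpha$, and, for some constant $C$, $\sum_{k=1}^{\alpha}k\,g^k_{\alpha,\beta}\le C(\alpha+\beta)$ for all $\alpha>0$, $\beta\ge0$. The mass migration process (MMP) with these data is the Markov process on $\mathfrak X$ with generator $$\mathcal L f(\eta)=\sum_{x,y\in X}\ \sum_{k>0}p(x,y)\,g^k_{\eta(x),\eta(y)}\bigl(f(S^k_{x,y}\eta)-f(\eta)\bigr)\qquad (f:\mathfrak X\to\mathbb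 R\text{ Lipschitz}),$$ where $S^k_{x,y}\eta$ is obtained from $\eta$ by moving $k$ particles from $x$ to $y$ (and $S^k_{x,y}\eta=\eta$ if $x=y$ or $k>\eta(x)$). That is, its transition probabilities $(P_t)_{t\ge0}$ form a semigroup of Markov kernels on $\mathfrak X$ which integrate Lipschitz functions and for which the operators $S(t)f(\eta)=\int f\,dP_t(\eta,\cdot)$ satisfy, for some constant $c$: if $f$ is Lipschitz with constant $L$, then $S(t)f$ is Lipschitz with constant $Le^{ct}$, and $S(t)f(\eta)=f(\eta)+\int_0^t\mathcal L S(s)f(\eta)\,ds$ for all $t\ge0$, $\eta\in\mathfrak X$. Let such a process be given. It is called *attractive* if for every bounded, continuous, nondecreasing $f:\mathfrak X\to\mathbb R$ and every $t>0$, the function $S(t)f$ is again bounded, continuous and nondecreasing. Write $\Sigma^k_{\alpha,\beta}=\sum_{k'>k}g^{k'}_{\alpha,\beta}=\sum_{k'=k+1}^{\alpha}g^{k'}_{\alpha,\beta}$. (a) The MMP is attractive if and only if for all $\alpha\ge1$, $\beta\ge0$, $k\ge0$, $$\Sigma^{k+1}_{\alpha+1,\beta}\le\Sigma^{k}_{\alpha,\beta}\le\Sigma^{k}_{\alpha+1,\beta}\qquad\text{and}\qquad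 \Sigma^{k+1}_{\alpha,\beta}\le\Sigma^{k}_{\alpha,\beta+1}\le\Sigma^{k}_{\alpha,\beta}.$$ (b) Suppose that the MMP is a mass migration zero range process (MM-ZRP), i.e. $g^k_{\alpha,\beta}=g^k_\alpha$ for $1\le k\le\alpha$ does not depend on $\beta$. Then it is attractive if and only if for all $\alpha\ge1$, $k\ge0$, $$\sum_{k'=k+2}^{\alpha+1}g^{k'}_{\alpha+1}\le\sum_{k'=k+1}^{\alpha}g^{k'}_{\alpha}\le\sum_{k'=k+1}^{\alpha+1}g^{k'}_{\alpha+1}.$$ (b') Under the assumption of (b), the MM-ZRP is attractive if and only if for all $\alpha\ge1$ and $1\le m\le\alpha$, $$0\le\sum_{j=0}^{m-1}\bigl(g^{\alpha-j}_{\alpha}-g^{\alpha+1-j}_{\alpha+1}\bigr)\le g^{\alpha+1-m}_{\alpha+1}.$$ (c) Suppose that the MMP is a mass migration target process (MM-TP), i.e. $g^k_{\alpha,\beta}=g^k_{*,\beta}$ whenever $1\le k\le\alpha$. Then it is attractive if and only if for all $\alpha\ge1$, $\beta\ge0$, $k\ge0$, $$g^{\alpha+1}_{*,\beta}\le g^{\alpha}_{*,\beta},\qquad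 g^{\alpha}_{*,\beta+1}\le g^{\alpha}_{*,\beta}\qquad\text{and}\qquad \sum_{k'=k+2}^{\alpha}g^{k'}_{*,\beta}\le\sum_{k'=k+1}^{\alpha}g^{k'}_{*,\beta+1}.$$ -/

import Mathlib

open MeasureTheory ProbabilityTheory
open scoped NNReal

/-- The data of a mass migration process on a set `X` of sites, with its standing assumptions:
an irreducible transition probability `p`, a positive summable weight `a`, and the rates `g`,
where `g k α β` is the quantity usually written with upper index `k` and lower indices `α, β`:
`k` particles jump from `x` to `y` at rate `p x y * g k (η x) (η y)`. -/
structure MassMigration (X : Type*) where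
  /-- the transition probability -/
  p : X → X → ℝ
  /-- the weight which defines the state space and its norm -/
  a : X → ℝ
  /-- the rates -/
  g : ℕ → ℕ → ℕ → ℝ
  p_nonneg : ∀ x y, 0 ≤ p x y
  p_hasSum : ∀ x, HasSum (fun y => p x y) 1
  p_irreducible : ∀ x y, Relation.ReflTransGen (fun u v => 0 < p u v) x y
  p_column : ∃ m : ℝ, ∀ y, Summable (fun x => p x y) ∧ ∑' x, p x y ≤ m
  a_pos : ∀ x, 0 < a x
  a_summable : Summable a
  a_compat : ∃ K : ℝ, ∀ x, ∑' y, p x y * a y + ∑' y, a y * p y x ≤ K * a x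
  g_nonneg : ∀ k α β, 0 ≤ g k α β
  g_zero : ∀ α β, g 0 α β = 0
  g_of_lt : ∀ k α β, α < k → g k α β = 0
  g_bound : ∃ C : ℝ, ∀ α β : ℕ, 0 < α →
    ∑ k ∈ Finset.Icc 1 α, (k : ℝ) * g k α β ≤ C * ((α : ℝ) + (β : ℝ))

namespace MassMigration

variable {X : Type*} (M : MassMigration X)

/-- The configurations `η : X → ℕ` with `∑ x, η x * a x < ∞`. -/
def State : Type _ := {η : X → ℕ // Summable fun x => (η x : ℝ) * M.a x}

variable {M}

theorem summable_absDiff (η ζ : M.State) :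
    Summable fun x => |(η.1 x : ℝ) - (ζ.1 x : ℝ)| * M.a x := by
  refine Summable.of_nonneg_of_le
    (fun x => mul_nonneg (abs_nonneg _) (M.a_pos x).le) (fun x => ?_) (η.2.add ζ.2)
  rw [← add_mul]
  refine mul_le_mul_of_nonneg_right ?_ (M.a_pos x).le
  rw [abs_le]
  constructor <;> linarith [Nat.cast_nonneg (α := ℝ) (η.1 x), Nat.cast_nonneg (α := ℝ) (ζ.1 x)]

/-- The distance `∑ x, |η x - ζ x| * a x`. -/
noncomputable instance : MetricSpace M.State where
  dist η ζ := ∑' x, |(η.1 x : ℝ) - (ζ.1 x : ℝ)| * M.a x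
  dist_self η := by simp
  dist_comm η ζ := by simp only [abs_sub_comm]
  dist_triangle η ξ ζ := by
    rw [← (summable_absDiff η ξ).tsum_add (summable_absDiff ξ ζ)]
    refine (summable_absDiff η ζ).tsum_le_tsum (fun x => ?_)
      ((summable_absDiff η ξ).add (summable_absDiff ξ ζ))
    rw [← add_mul]
    exact mul_le_mul_of_nonneg_right (abs_sub_le _ _ _) (M.a_pos x).le
  eq_of_dist_eq_zero {η ζ} h := by
    refine Subtype.ext (funext fun x => ?_)
    have hs := (hasSum_zero_iff_of_nonneg
      (fun x => mul_nonneg (abs_nonneg _) (M.a_pos x).le)).1 (h ▸ (summable_absDiff η ζ).hasSum)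
    have hx := congrFun hs x
    simp only [Pi.zero_apply, mul_eq_zero, (M.a_pos x).ne', or_false, abs_eq_zero] at hx
    exact_mod_cast sub_eq_zero.1 hx

/-- The coordinatewise order. -/
instance : PartialOrder M.State := PartialOrder.lift Subtype.val Subtype.val_injective

/-- The Borel σ-algebra (for countable `X`, the trace of the product σ-algebra). -/
noncomputable instance : MeasurableSpace M.State := borel _

instance : BorelSpace M.State := ⟨rfl⟩

open Classical in
/-- The configuration after `k` particles have moved from `x` to `y`. Nothing happens if fewer
than `k` particles sit at `x`, nor if `x = y`: the total number of particles is conserved. -/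
noncomputable def jump (η : M.State) (x y : X) (k : ℕ) : M.State :=
  ⟨fun z => if k ≤ η.1 x then (η.1 z - if z = x then k else 0) + (if z = y then k else 0)
      else η.1 z, by
    have h : Summable fun z => ((if z = y then k else 0 : ℕ) : ℝ) * M.a z :=
      summable_of_ne_finset_zero (s := {y}) (by intro z hz; simp at hz; simp [hz])
    refine Summable.of_nonneg_of_le
      (fun z => mul_nonneg (Nat.cast_nonneg _) (M.a_pos z).le) (fun z => ?_) (η.2.add h)
    rw [← add_mul]
    refine mul_le_mul_of_nonneg_right ?_ (M.a_pos z).le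
    norm_cast
    beta_reduce
    split_ifs <;> omega⟩

/-- `f` is Lipschitz with constant `L` for the weighted distance. -/
def IsLip (L : ℝ) (f : M.State → ℝ) : Prop := ∀ η ζ, |f η - f ζ| ≤ L * dist η ζ

/-- The infinitesimal generator, meant for Lipschitz `f` (the sum then converges absolutely). -/
noncomputable def generator (f : M.State → ℝ) (η : M.State) : ℝ :=
  ∑' e : X × X, ∑ k ∈ Finset.Icc 1 (η.1 e.1),
    M.p e.1 e.2 * M.g k (η.1 e.1) (η.1 e.2) * (f (jump η e.1 e.2 k) - f η)

/-- `S(t) f (η)`, the expectation of `f` at time `t` for the transition probabilities `P`. -/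
noncomputable def semigroup (P : ℝ≥0 → Kernel M.State M.State) (t : ℝ≥0)
    (f : M.State → ℝ) (η : M.State) : ℝ :=
  ∫ ζ, f ζ ∂(P t η)

/-- `P` is the family of transition probabilities of the Markov process on `M.State` whose
generator is `generator`: its Markov semigroup `S(t)` acts on the Lipschitz functions, with
Lipschitz constants growing at most exponentially in time, and
`S(t) f = f + ∫ s in 0..t, generator (S(s) f)` for every Lipschitz `f`. There is at most one such
family: on configurations with a given finite number of particles the equation has bounded
coefficients, and such configurations are dense. -/
structure IsTransitionSemigroup (P : ℝ≥0 → Kernel M.State M.State) : Prop where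
  markov : ∀ t, IsMarkovKernel (P t)
  zero : P 0 = Kernel.id
  add : ∀ s t, P (s + t) = P t ∘ₖ P s
  integrable : ∀ (L : ℝ) (f : M.State → ℝ), IsLip L f → ∀ t η, Integrable f (P t η)
  lipschitz : ∃ c : ℝ, ∀ (L : ℝ) (f : M.State → ℝ), IsLip L f →
    ∀ t : ℝ≥0, IsLip (L * Real.exp (c * t)) (semigroup P t f)
  equation : ∀ (L : ℝ) (f : M.State → ℝ), IsLip L f → ∀ (t : ℝ≥0) (η : M.State),
    IntervalIntegrable (fun s : ℝ => generator (semigroup P s.toNNReal f) η) volume 0 t ∧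
    semigroup P t f η = f η + ∫ s in (0 : ℝ)..t, generator (semigroup P s.toNNReal f) η

/-- The semigroup preserves the class of bounded, monotone, continuous functions. -/
def Attractive (P : ℝ≥0 → Kernel M.State M.State) : Prop :=
  ∀ f : M.State → ℝ, (∃ B, ∀ η, |f η| ≤ B) → Monotone f → Continuous f → ∀ t : ℝ≥0, 0 < t →
    (∃ B, ∀ η, |semigroup P t f η| ≤ B) ∧ Monotone (semigroup P t f) ∧
      Continuous (semigroup P t f)

variable (M)

/-- The tail sum `∑_{k' > k} g k' α β`; the terms with `k' > α` vanish. -/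
noncomputable def tail (k α β : ℕ) : ℝ := ∑ k' ∈ Finset.Ioc k α, M.g k' α β

/-- Mass migration zero range process: the rates are `h k α`, whatever the arrival site. -/
def IsZeroRange (h : ℕ → ℕ → ℝ) : Prop :=
  ∀ k α β, 1 ≤ k → k ≤ α → M.g k α β = h k α

/-- Mass migration target process: the rates are `h k β`, provided that `k` particles are
available. -/
def IsTarget (h : ℕ → ℕ → ℝ) : Prop :=
  ∀ k α β, 1 ≤ k → k ≤ α → M.g k α β = h k β

end MassMigration

/-! By Abel summation the generator sees the rates along an edge only through the tails Σ^k. Give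
one of two configurations an extra particle at `z`. If `z` is the departure site, the conditions
interlace the two families of tails; if `z` is the arrival site, they interlace in the other order.
Coupling the jump sizes by quantiles, they differ by at most one, and after the jump the
configurations still differ by one extra particle. `TailCondition.genTerm_sub` records this as an
inequality for the generator.

On configurations with at most N particles the total jump rate is bounded, so the one-particle
increments of S(t)f can be controlled by a differential inequality, without constructing a coupled
process: a lower bound on all increments improves to half of itself, hence to zero
(`TailCondition.semigroup_le_addAt_one`). Density of finite configurations gives monotonicity
everywhere for Lipschitz f, and a monotone Lipschitz approximation passes to continuous f.

Conversely, if f is monotone, η ≤ ζ and f(η) = f(ζ), differentiating S(t)f at t = 0 gives 𝓛f(η) ≤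
𝓛f(ζ) (`Attractive.generator_le`). Indicators that detect many arrivals at y, or many departures
from x, turn this into inequalities between tails (`Attractive.gain_le`, `Attractive.loss_le`). The
zero range and target versions are algebra on tails. -/

namespace MassMigration

section

variable {X : Type*} {M : MassMigration X}

open scoped Classical Topology
open Filter Finset

/-! ### Rates and finite configurations -/

theorem tail_nonneg (k α β : ℕ) : 0 ≤ M.tail k α β :=
  sum_nonneg fun _ _ => M.g_nonneg _ _ _

theorem tail_eq_zero {k α : ℕ} (β : ℕ) (h : α ≤ k) : M.tail k α β = 0 := by
  simp [tail, Finset.Ioc_eq_empty_of_le h]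

theorem exists_tail_le : ∃ C : ℝ, 0 ≤ C ∧ ∀ α β : ℕ, M.tail 0 α β ≤ C * ((α : ℝ) + β) := by
  obtain ⟨C, hC⟩ := M.g_bound
  refine ⟨|C|, abs_nonneg C, fun α β => ?_⟩
  rcases Nat.eq_zero_or_pos α with rfl | hα
  · rw [tail_eq_zero _ le_rfl]; positivity
  calc M.tail 0 α β ≤ ∑ k ∈ Icc 1 α, (k : ℝ) * M.g k α β := by
        refine sum_le_sum fun k hk => ?_
        have : (1 : ℝ) ≤ k := by exact_mod_cast (mem_Icc.1 hk).1
        nlinarith [M.g_nonneg k α β]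
    _ ≤ C * ((α : ℝ) + β) := hC α β hα
    _ ≤ |C| * ((α : ℝ) + β) := mul_le_mul_of_nonneg_right (le_abs_self C) (by positivity)

/-- The configuration has at most `N` particles. -/
def AtMost (N : ℕ) (η : M.State) : Prop := ∀ F : Finset X, ∑ x ∈ F, η.1 x ≤ N

theorem AtMost.mono {N N' : ℕ} {η : M.State} (h : AtMost N η) (hN : N ≤ N') : AtMost N' η :=
  fun F => (h F).trans hN

theorem AtMost.real_sum_le {N : ℕ} {η : M.State} (h : AtMost N η) (F : Finset X) :
    ∑ x ∈ F, (η.1 x : ℝ) ≤ N := by exact_mod_cast h F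

theorem AtMost.summable {N : ℕ} {η : M.State} (h : AtMost N η) :
    Summable fun x => (η.1 x : ℝ) :=
  summable_of_sum_le (fun _ => Nat.cast_nonneg _) h.real_sum_le

theorem AtMost.tsum_le {N : ℕ} {η : M.State} (h : AtMost N η) : ∑' x, (η.1 x : ℝ) ≤ N :=
  h.summable.tsum_le_of_sum_le h.real_sum_le

theorem summable_prod_of_rows {F : X × X → ℝ} (hF : ∀ e, 0 ≤ F e) {b : X → ℝ} (hb : Summable b)
    (hr : ∀ x, Summable fun y => F (x, y)) (hle : ∀ x, ∑' y, F (x, y) ≤ b x) :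
    Summable F ∧ ∑' e, F e ≤ ∑' x, b x := by
  have hs : Summable fun x => ∑' y, F (x, y) :=
    Summable.of_nonneg_of_le (fun x => tsum_nonneg fun y => hF _) hle hb
  have hS : Summable F := (summable_prod_of_nonneg hF).2 ⟨hr, hs⟩
  exact ⟨hS, by rw [hS.tsum_prod]; exact hs.tsum_le_tsum hle hb⟩

/-- The total rate at which particles move along `e`, the departure site being read in `η` and
the arrival site in `ζ`. -/
noncomputable def rate (η ζ : M.State) (e : X × X) : ℝ :=
  M.p e.1 e.2 * M.tail 0 (η.1 e.1) (ζ.1 e.2)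

theorem rate_nonneg (η ζ : M.State) (e : X × X) : 0 ≤ rate η ζ e :=
  mul_nonneg (M.p_nonneg _ _) (tail_nonneg _ _ _)

theorem summable_p_mul_fst {u : X → ℝ} (hu : ∀ x, 0 ≤ u x) (hs : Summable u) :
    Summable (fun e : X × X => M.p e.1 e.2 * u e.1) ∧
      ∑' e : X × X, M.p e.1 e.2 * u e.1 ≤ ∑' x, u x := by
  refine summable_prod_of_rows (fun e => mul_nonneg (M.p_nonneg _ _) (hu _)) hs (fun x => ?_)
    (fun x => ?_)
  · exact (M.p_hasSum x).summable.mul_right (u x)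
  · exact ((M.p_hasSum x).mul_right (u x)).tsum_eq.le.trans (one_mul _).le

theorem summable_p_mul_snd {m : ℝ} (hm : ∀ y, Summable (fun x => M.p x y) ∧ ∑' x, M.p x y ≤ m)
    {u : X → ℝ} (hu : ∀ x, 0 ≤ u x) (hs : Summable u) :
    Summable (fun e : X × X => M.p e.1 e.2 * u e.2) ∧
      ∑' e : X × X, M.p e.1 e.2 * u e.2 ≤ m * ∑' x, u x := by
  have h : Summable (fun e : X × X => M.p e.2 e.1 * u e.1) ∧
      ∑' e : X × X, M.p e.2 e.1 * u e.1 ≤ ∑' x, m * u x := by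
    refine summable_prod_of_rows (fun e => mul_nonneg (M.p_nonneg _ _) (hu _)) (hs.mul_left m)
      (fun x => ?_) (fun x => ?_)
    · exact (hm x).1.mul_right (u x)
    · exact ((hm x).1.tsum_mul_right (u x)).le.trans
        (mul_le_mul_of_nonneg_right (hm x).2 (hu x))
  rw [tsum_mul_left] at h
  exact ⟨(Equiv.prodComm X X).summable_iff.1 h.1,
    ((Equiv.prodComm X X).tsum_eq (fun e : X × X => M.p e.1 e.2 * u e.2)).symm.le.trans h.2⟩

/-- The rates grow at most linearly: row sums of `p` control the departure part, and the bounded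
column sums control the arrival part. The bound depends on `N` only, which makes the later
differential inequality uniform. -/
theorem exists_rate_bound (N : ℕ) : ∃ R : ℝ, ∀ η ζ : M.State, AtMost N η → AtMost N ζ →
    Summable (rate η ζ) ∧ ∑' e, rate η ζ e ≤ R := by
  obtain ⟨C, hC0, hC⟩ := M.exists_tail_le
  obtain ⟨m, hm⟩ := M.p_column
  refine ⟨C * (N + |m| * N), fun η ζ hη hζ => ?_⟩
  have h1 := M.summable_p_mul_fst (fun x => Nat.cast_nonneg (η.1 x)) hη.summable
  have h2 := M.summable_p_mul_snd (m := |m|) (fun y => ⟨(hm y).1, (hm y).2.trans (le_abs_self m)⟩)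
    (fun x => Nat.cast_nonneg (ζ.1 x)) hζ.summable
  have hle : ∀ e, rate η ζ e ≤
      C * (M.p e.1 e.2 * (η.1 e.1 : ℝ) + M.p e.1 e.2 * (ζ.1 e.2 : ℝ)) := fun e => by
    have := mul_le_mul_of_nonneg_left (hC (η.1 e.1) (ζ.1 e.2)) (M.p_nonneg e.1 e.2)
    unfold rate
    linarith
  have hsum := (h1.1.add h2.1).mul_left C
  have hrs : Summable (rate η ζ) := Summable.of_nonneg_of_le (rate_nonneg η ζ) hle hsum
  refine ⟨hrs, (hrs.tsum_le_tsum hle hsum).trans ?_⟩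
  rw [tsum_mul_left, h1.1.tsum_add h2.1]
  exact mul_le_mul_of_nonneg_left (add_le_add (h1.2.trans hη.tsum_le)
    (h2.2.trans (mul_le_mul_of_nonneg_left hζ.tsum_le (abs_nonneg m)))) hC0

/-! ### Jumps -/

theorem jump_apply (η : M.State) (x y : X) {k : ℕ} (h : k ≤ η.1 x) (z : X) :
    (jump η x y k).1 z = (η.1 z - if z = x then k else 0) + (if z = y then k else 0) := by
  simp [jump, h]

theorem jump_of_lt (η : M.State) (x y : X) {k : ℕ} (h : η.1 x < k) : jump η x y k = η :=
  Subtype.ext (funext fun z => by simp [jump, Nat.not_le.2 h])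

theorem jump_zero (η : M.State) (x y : X) : jump η x y 0 = η :=
  Subtype.ext (funext fun z => by simp [jump])

theorem jump_self (η : M.State) (x : X) (k : ℕ) : jump η x x k = η := by
  rcases lt_or_ge (η.1 x) k with h | h
  · exact jump_of_lt η x x h
  · refine Subtype.ext (funext fun z => ?_)
    rw [jump_apply η x x h]
    split_ifs with hz
    · subst hz; omega
    · simp

theorem AtMost.jump {N : ℕ} {η : M.State} (hη : AtMost N η) (x y : X) (k : ℕ) :
    AtMost N (jump η x y k) := by
  rcases lt_or_ge (η.1 x) k with h | h
  · rwa [jump_of_lt η x y h]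
  intro F
  -- On a set containing both endpoints the particle count is conserved exactly; adding `k` to both
  -- sides undoes the truncated subtraction.
  have hs : ∑ z ∈ insert x (insert y F), (MassMigration.jump η x y k).1 z + k
      = ∑ z ∈ insert x (insert y F), η.1 z + k := by
    have h1 : ∑ z ∈ insert x (insert y F), (if z = x then k else 0) = k := by simp
    have h2 : ∑ z ∈ insert x (insert y F), (if z = y then k else 0) = k := by simp
    refine (congrArg (_ + ·) h1.symm).trans (Eq.trans ?_ (congrArg (_ + ·) h2))
    rw [← sum_add_distrib, ← sum_add_distrib]
    refine sum_congr rfl fun z _ => ?_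
    rw [jump_apply η x y h]
    by_cases hz : z = x
    · subst hz; simp only [if_true]; omega
    · simp [hz]
  calc ∑ z ∈ F, (MassMigration.jump η x y k).1 z
      ≤ ∑ z ∈ insert x (insert y F), (MassMigration.jump η x y k).1 z :=
        sum_le_sum_of_subset ((subset_insert _ _).trans (subset_insert _ _))
    _ = ∑ z ∈ insert x (insert y F), η.1 z := by omega
    _ ≤ N := hη _

/-- The configuration with `n` more particles at `z`. -/
noncomputable def addAt (η : M.State) (z : X) (n : ℕ) : M.State :=
  ⟨fun w => η.1 w + if w = z then n else 0, by
    have h : Summable fun w => ((if w = z then n else 0 : ℕ) : ℝ) * M.a w :=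
      summable_of_ne_finset_zero (s := {z}) (by intro w hw; simp at hw; simp [hw])
    simpa [add_mul] using η.2.add h⟩

theorem addAt_apply (η : M.State) (z : X) (n : ℕ) (w : X) :
    (addAt η z n).1 w = η.1 w + if w = z then n else 0 := rfl

theorem addAt_zero (η : M.State) (z : X) : addAt η z 0 = η :=
  Subtype.ext (funext fun w => by simp [addAt_apply])

theorem addAt_succ (η : M.State) (z : X) (n : ℕ) : addAt η z (n + 1) = addAt (addAt η z n) z 1 :=
  Subtype.ext (funext fun w => by simp only [addAt_apply]; split_ifs <;> omega)

theorem le_addAt (η : M.State) (z : X) (n : ℕ) : η ≤ addAt η z n :=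
  fun w => by simp [addAt_apply]

theorem AtMost.addAt {N : ℕ} {η : M.State} (h : AtMost N η) (z : X) (n : ℕ) :
    AtMost (N + n) (addAt η z n) := fun F => by
  have h1 : ∑ w ∈ F, (if w = z then n else 0) ≤ n := by
    rw [sum_ite_eq']; split_ifs <;> simp
  simpa only [addAt_apply, sum_add_distrib] using add_le_add (h F) h1

/-- This and the next two lemmas list the outcomes of a coupled jump: the extra particle stays at
`z`, travels with the jump to `y`, or, when `z` is the target, is replaced by one left behind at
`x`. -/
theorem jump_addAt {η : M.State} {x z : X} (y : X) {k : ℕ} (h : k ≤ η.1 x) :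
    jump (addAt η z 1) x y k = addAt (jump η x y k) z 1 := by
  refine Subtype.ext (funext fun w => ?_)
  have h' : k ≤ (addAt η z 1).1 x := h.trans (le_addAt η z 1 x)
  rw [jump_apply _ _ _ h', addAt_apply, addAt_apply, jump_apply _ _ _ h]
  by_cases hw : w = x
  · subst hw; simp only [if_true]; split_ifs <;> omega
  · simp only [hw, if_false]; omega

theorem jump_succ_addAt_source {η : M.State} {y z : X} (hy : y ≠ z) {k : ℕ} (h : k ≤ η.1 z) :
    jump (addAt η z 1) z y (k + 1) = addAt (jump η z y k) y 1 := by
  refine Subtype.ext (funext fun w => ?_)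
  have h' : k + 1 ≤ (addAt η z 1).1 z := by simpa [addAt_apply] using h
  rw [jump_apply _ _ _ h', addAt_apply, addAt_apply, jump_apply _ _ _ h]
  by_cases hw : w = z
  · subst hw; simp only [if_true]; split_ifs <;> omega
  · simp only [hw, if_false]; split_ifs <;> omega

theorem jump_addAt_target {η : M.State} {x z : X} (hx : x ≠ z) {k : ℕ} (h : k + 1 ≤ η.1 x) :
    jump (addAt η z 1) x z k = addAt (jump η x z (k + 1)) x 1 := by
  refine Subtype.ext (funext fun w => ?_)
  have h' : k ≤ (addAt η z 1).1 x := (Nat.le_of_succ_le h).trans (le_addAt η z 1 x)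
  rw [jump_apply _ _ _ h', addAt_apply, addAt_apply, jump_apply _ _ _ h]
  by_cases hw : w = x
  · subst hw; simp only [if_true, hx, if_false]; omega
  · simp only [hw, if_false]; split_ifs <;> omega

/-! ### The generator on finite configurations -/

/-- The contribution of the jumps along `e` to the generator. -/
noncomputable def genTerm (f : M.State → ℝ) (η : M.State) (e : X × X) : ℝ :=
  ∑ k ∈ Icc 1 (η.1 e.1),
    M.p e.1 e.2 * M.g k (η.1 e.1) (η.1 e.2) * (f (jump η e.1 e.2 k) - f η)

theorem abs_genTerm_le {f : M.State → ℝ} {B : ℝ} (hf : ∀ ξ, |f ξ| ≤ B) (η : M.State)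
    (e : X × X) : |genTerm f η e| ≤ rate η η e * (2 * B) := by
  refine (abs_sum_le_sum_abs _ _).trans ?_
  rw [rate, tail, mul_sum, sum_mul]
  refine sum_le_sum fun k _ => ?_
  rw [abs_mul, abs_of_nonneg (mul_nonneg (M.p_nonneg _ _) (M.g_nonneg _ _ _))]
  refine mul_le_mul_of_nonneg_left ?_ (mul_nonneg (M.p_nonneg _ _) (M.g_nonneg _ _ _))
  have h1 := abs_le.1 (hf (jump η e.1 e.2 k))
  have h2 := abs_le.1 (hf η)
  exact abs_le.2 ⟨by linarith, by linarith⟩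

theorem AtMost.summable_rate {N : ℕ} {η : M.State} (hη : AtMost N η) : Summable (rate η η) :=
  let ⟨_, hR⟩ := exists_rate_bound (M := M) N
  (hR η η hη hη).1

theorem AtMost.summable_genTerm {N : ℕ} {η : M.State} (hη : AtMost N η) {f : M.State → ℝ} {B : ℝ}
    (hf : ∀ ξ, |f ξ| ≤ B) : Summable (genTerm f η) :=
  Summable.of_norm_bounded (hη.summable_rate.mul_right (2 * B)) (abs_genTerm_le hf η)

/-! ### Coupling -/

/-- Abel summation: telescope `H k - H 0` and exchange the sums. -/
theorem sum_mul_sub_eq_sum_tail (g H : ℕ → ℝ) (n : ℕ) :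
    ∑ k ∈ Icc 1 n, g k * (H k - H 0)
      = ∑ j ∈ range n, (∑ k ∈ Ioc j n, g k) * (H (j + 1) - H j) := by
  simp_rw [← sum_range_sub, mul_sum, sum_mul]
  refine sum_comm' fun k j => ?_
  simp only [mem_Icc, mem_range, mem_Ioc]
  omega

/-- Quantile coupling for T' 0 ≥ T 0 ≥ T' 1 ≥ T 1 ≥ …, where `T'`, `H` belong to the larger
configuration. On a slice of length `T' k - T k` the larger one moves `k + 1` particles and the
smaller one `k`; on a slice of length `T k - T' (k + 1)` both move `k + 1`. The slices fill `T' 0`,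
and each outcome loses at most `ε`. -/
theorem coupling_source {T T' H G : ℕ → ℝ} {ε : ℝ} {n : ℕ} (h1 : ∀ k, T' (k + 1) ≤ T k)
    (h2 : ∀ k, T k ≤ T' k) (hT : T n = 0) (hT' : T' (n + 1) = 0)
    (hA : ∀ k ≤ n, -ε ≤ H k - G k) (hB : ∀ k ≤ n, -ε ≤ H (k + 1) - G k) :
    -(T' 0 * (H 0 - G 0 + ε)) ≤ ∑ k ∈ range (n + 1), T' k * (H (k + 1) - H k)
      - ∑ k ∈ range n, T k * (G (k + 1) - G k) := by
  have key : ∀ m, ∑ k ∈ range m, T' k * (H (k + 1) - H k) - ∑ k ∈ range m, T k * (G (k + 1) - G k)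
      + T' 0 * (H 0 - G 0 + ε) = ∑ k ∈ range m, (T' k - T k) * (H (k + 1) - G k + ε)
        + ∑ k ∈ range m, (T k - T' (k + 1)) * (H (k + 1) - G (k + 1) + ε)
        + T' m * (H m - G m + ε) := by
    intro m
    induction m with
    | zero => simp
    | succ m ih => simp only [sum_range_succ]; linear_combination ih
  have hk := key (n + 1)
  -- The last terms vanish; in particular no bound is needed on `H (n + 1) - G (n + 1)`, where the
  -- smaller configuration would lack a particle.
  rw [sum_range_succ (fun k => T k * _), sum_range_succ (fun k => (T k - T' (k + 1)) * _), hT,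
    hT'] at hk
  have s1 : 0 ≤ ∑ k ∈ range (n + 1), (T' k - T k) * (H (k + 1) - G k + ε) :=
    sum_nonneg fun k hk => mul_nonneg (sub_nonneg.2 (h2 k))
      (by linarith [hB k (Nat.lt_succ_iff.1 (mem_range.1 hk))])
  have s2 : 0 ≤ ∑ k ∈ range n, (T k - T' (k + 1)) * (H (k + 1) - G (k + 1) + ε) :=
    sum_nonneg fun k hk => mul_nonneg (sub_nonneg.2 (h1 k))
      (by linarith [hA (k + 1) (mem_range.1 hk)])
  linarith

/-- Now T 0 ≥ T' 0 ≥ T 1 ≥ T' 1 ≥ …: slices of length `T k - T' k` move `k + 1` particles in the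
smaller configuration and `k` in the larger, the others move `k + 1` in both. -/
theorem coupling_target {T T' H G : ℕ → ℝ} {ε : ℝ} {n : ℕ} (h1 : ∀ k, T (k + 1) ≤ T' k)
    (h2 : ∀ k, T' k ≤ T k) (hT : T n = 0)
    (hA : ∀ k ≤ n, -ε ≤ H k - G k) (hC : ∀ k < n, -ε ≤ H k - G (k + 1)) :
    -(T 0 * (H 0 - G 0 + ε)) ≤ ∑ k ∈ range n, T' k * (H (k + 1) - H k)
      - ∑ k ∈ range n, T k * (G (k + 1) - G k) := by
  have key : ∀ m, ∑ k ∈ range m, T' k * (H (k + 1) - H k) - ∑ k ∈ range m, T k * (G (k + 1) - G k)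
      + T 0 * (H 0 - G 0 + ε) = ∑ k ∈ range m, (T k - T' k) * (H k - G (k + 1) + ε)
        + ∑ k ∈ range m, (T' k - T (k + 1)) * (H (k + 1) - G (k + 1) + ε)
        + T m * (H m - G m + ε) := by
    intro m
    induction m with
    | zero => simp
    | succ m ih => simp only [sum_range_succ]; linear_combination ih
  have hk := key n
  rw [hT] at hk
  have s1 : 0 ≤ ∑ k ∈ range n, (T k - T' k) * (H k - G (k + 1) + ε) :=
    sum_nonneg fun k hk => mul_nonneg (sub_nonneg.2 (h2 k))
      (by linarith [hC k (mem_range.1 hk)])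
  have s2 : 0 ≤ ∑ k ∈ range n, (T' k - T (k + 1)) * (H (k + 1) - G (k + 1) + ε) :=
    sum_nonneg fun k hk => mul_nonneg (sub_nonneg.2 (h1 k))
      (by linarith [hA (k + 1) (mem_range.1 hk)])
  linarith

theorem genTerm_eq_sum_tail (f : M.State → ℝ) (η : M.State) (e : X × X) :
    genTerm f η e = M.p e.1 e.2 * ∑ k ∈ range (η.1 e.1), M.tail k (η.1 e.1) (η.1 e.2)
      * (f (jump η e.1 e.2 (k + 1)) - f (jump η e.1 e.2 k)) := by
  have := sum_mul_sub_eq_sum_tail (fun k => M.g k (η.1 e.1) (η.1 e.2))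
    (fun k => f (jump η e.1 e.2 k)) (η.1 e.1)
  simp only [jump_zero] at this
  simp only [tail, ← this, genTerm, mul_sum, mul_assoc]

/-- The inequalities between tail sums which characterize attractiveness. -/
def TailCondition (M : MassMigration X) : Prop := ∀ α β k : ℕ, 1 ≤ α →
  (M.tail (k + 1) (α + 1) β ≤ M.tail k α β ∧ M.tail k α β ≤ M.tail k (α + 1) β) ∧
  (M.tail (k + 1) α β ≤ M.tail k α (β + 1) ∧ M.tail k α (β + 1) ≤ M.tail k α β)

/-- The restriction to α ≥ 1 costs nothing: for α = 0 the two smaller tails are empty sums. -/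
theorem TailCondition.source (hM : M.TailCondition) (α β k : ℕ) :
    M.tail (k + 1) (α + 1) β ≤ M.tail k α β ∧ M.tail k α β ≤ M.tail k (α + 1) β := by
  rcases Nat.eq_zero_or_pos α with rfl | h
  · rw [tail_eq_zero β (Nat.zero_le k), tail_eq_zero β (by omega)]
    exact ⟨le_rfl, tail_nonneg _ _ _⟩
  · exact (hM α β k h).1

theorem TailCondition.target (hM : M.TailCondition) (α β k : ℕ) :
    M.tail (k + 1) α β ≤ M.tail k α (β + 1) ∧ M.tail k α (β + 1) ≤ M.tail k α β := by
  rcases Nat.eq_zero_or_pos α with rfl | h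
  · simp only [tail_eq_zero _ (Nat.zero_le _), le_refl, and_self]
  · exact (hM α β k h).2

/-- The total rate of the coupled jumps is the larger of the two tails of index 0. By the condition
this is the tail with departure read in the larger configuration and arrival in the smaller, whence
the mixed arguments of `rate`. -/
theorem TailCondition.genTerm_sub (hM : M.TailCondition) {f : M.State → ℝ} {ε : ℝ} {N : ℕ}
    (hf : ∀ ξ w, AtMost N ξ → -ε ≤ f (addAt ξ w 1) - f ξ) {η : M.State} (hη : AtMost N η)
    (z : X) (e : X × X) :
    -(rate (addAt η z 1) η e * (f (addAt η z 1) - f η + ε))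
      ≤ genTerm f (addAt η z 1) e - genTerm f η e := by
  obtain ⟨x, y⟩ := e
  have hu : 0 ≤ f (addAt η z 1) - f η + ε := by linarith [hf η z hη]
  by_cases hxy : x = y
  · subst hxy
    simp only [genTerm, jump_self, sub_self, mul_zero, sum_const_zero]
    linarith [mul_nonneg (rate_nonneg (addAt η z 1) η (x, x)) hu]
  by_cases hxz : x = z
  · subst hxz
    have h1 : (addAt η x 1).1 x = η.1 x + 1 := by simp [addAt_apply]
    have h2 : (addAt η x 1).1 y = η.1 y := by simp [addAt_apply, Ne.symm hxy]
    have := coupling_source (T := fun k => M.tail k (η.1 x) (η.1 y))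
      (T' := fun k => M.tail k (η.1 x + 1) (η.1 y)) (n := η.1 x) (ε := ε)
      (H := fun k => f (jump (addAt η x 1) x y k)) (G := fun k => f (jump η x y k))
      (fun k => (hM.source _ _ k).1) (fun k => (hM.source _ _ k).2) (tail_eq_zero _ le_rfl)
      (tail_eq_zero _ le_rfl)
      (fun k hk => by simpa only [jump_addAt y hk] using hf _ _ (hη.jump x y k))
      (fun k hk => by
        simpa only [jump_succ_addAt_source (Ne.symm hxy) hk] using hf _ _ (hη.jump x y k))
    rw [genTerm_eq_sum_tail, genTerm_eq_sum_tail, rate, ← mul_sub, mul_assoc, ← mul_neg]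
    simp only [h1, h2]
    simp only [jump_zero] at this
    exact mul_le_mul_of_nonneg_left this (M.p_nonneg _ _)
  have h1 : (addAt η z 1).1 x = η.1 x := by simp [addAt_apply, hxz]
  by_cases hyz : y = z
  · subst hyz
    have h2 : (addAt η y 1).1 y = η.1 y + 1 := by simp [addAt_apply]
    have := coupling_target (T := fun k => M.tail k (η.1 x) (η.1 y))
      (T' := fun k => M.tail k (η.1 x) (η.1 y + 1)) (n := η.1 x) (ε := ε)
      (H := fun k => f (jump (addAt η y 1) x y k)) (G := fun k => f (jump η x y k))
      (fun k => (hM.target _ _ k).1) (fun k => (hM.target _ _ k).2) (tail_eq_zero _ le_rfl)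
      (fun k hk => by simpa only [jump_addAt y hk] using hf _ _ (hη.jump x y k))
      (fun k hk => by
        simpa only [jump_addAt_target hxz hk] using hf _ _ (hη.jump x y (k + 1)))
    rw [genTerm_eq_sum_tail, genTerm_eq_sum_tail, rate, ← mul_sub, mul_assoc, ← mul_neg]
    simp only [h1, h2]
    simp only [jump_zero] at this
    exact mul_le_mul_of_nonneg_left this (M.p_nonneg _ _)
  -- Neither endpoint sees the extra particle, so both configurations jump together with equal
  -- rates.
  have h2 : (addAt η z 1).1 y = η.1 y := by simp [addAt_apply, hyz]
  simp only [genTerm, rate, tail, h1, h2, ← sum_sub_distrib]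
  rw [mul_sum, sum_mul, ← sum_neg_distrib]
  refine sum_le_sum fun k hk => ?_
  have hk' : k ≤ η.1 x := (mem_Ioc.1 hk).2
  rw [← mul_sub, ← mul_neg, jump_addAt y hk']
  exact mul_le_mul_of_nonneg_left (by linarith [hf _ z (hη.jump x y k)])
    (mul_nonneg (M.p_nonneg _ _) (M.g_nonneg _ _ _))

theorem TailCondition.generator_sub (hM : M.TailCondition) {f : M.State → ℝ} {B ε R : ℝ} {N : ℕ}
    (hB : ∀ ξ, |f ξ| ≤ B) (hf : ∀ ξ w, AtMost N ξ → -ε ≤ f (addAt ξ w 1) - f ξ)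
    (hR : ∀ η ζ : M.State, AtMost (N + 1) η → AtMost (N + 1) ζ →
      Summable (rate η ζ) ∧ ∑' e, rate η ζ e ≤ R)
    {η : M.State} (hη : AtMost N η) (z : X) :
    -(R * (f (addAt η z 1) - f η + ε)) ≤ generator f (addAt η z 1) - generator f η := by
  have h1 := hR (addAt η z 1) η (hη.addAt z 1) (hη.mono N.le_succ)
  have hs := (hη.addAt z 1).summable_genTerm hB
  have hs' := hη.summable_genTerm hB
  calc -(R * (f (addAt η z 1) - f η + ε))
      ≤ -((∑' e, rate (addAt η z 1) η e) * (f (addAt η z 1) - f η + ε)) :=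
        neg_le_neg (mul_le_mul_of_nonneg_right h1.2 (by linarith [hf η z hη]))
    _ = ∑' e, -(rate (addAt η z 1) η e * (f (addAt η z 1) - f η + ε)) := by
        rw [tsum_neg, tsum_mul_right]
    _ ≤ ∑' e, (genTerm f (addAt η z 1) e - genTerm f η e) :=
        (h1.1.mul_right _).neg.tsum_le_tsum (hM.genTerm_sub hf hη z) (hs.sub hs')
    _ = generator f (addAt η z 1) - generator f η := hs.tsum_sub hs'

variable {P : ℝ≥0 → Kernel M.State M.State}

/-! ### Regularity of the semigroup in time -/

theorem IsTransitionSemigroup.abs_semigroup_le (hP : IsTransitionSemigroup P) {f : M.State → ℝ}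
    {B : ℝ} (hB : ∀ ξ, |f ξ| ≤ B) (t : ℝ≥0) (η : M.State) : |semigroup P t f η| ≤ B := by
  have := hP.markov t
  have h := norm_integral_le_of_norm_le_const (μ := P t η) (f := f) (C := B)
    (Eventually.of_forall hB)
  rwa [probReal_univ, mul_one] at h

theorem IsTransitionSemigroup.semigroup_zero (hP : IsTransitionSemigroup P) {L : ℝ}
    {f : M.State → ℝ} (hf : IsLip L f) (η : M.State) : semigroup P 0 f η = f η := by
  simpa using (hP.equation L f hf 0 η).2

theorem IsTransitionSemigroup.continuous_semigroup (hP : IsTransitionSemigroup P) {L : ℝ}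
    {f : M.State → ℝ} (hf : IsLip L f) (η : M.State) :
    Continuous fun t : ℝ => semigroup P t.toNNReal f η := by
  set h : ℝ → ℝ := fun s => generator (semigroup P s.toNNReal f) η with hh
  have h0 : ∀ b, IntervalIntegrable h volume 0 b := fun b => by
    rcases le_total 0 b with hb | hb
    · simpa [hb] using (hP.equation L f hf b.toNNReal η).1
    -- For negative times `Real.toNNReal` freezes the integrand at its value at 0.
    · refine (intervalIntegrable_const (c := h 0)).congr fun s hs => ?_
      rw [Set.uIoc_of_ge hb] at hs
      simp [hh, Real.toNNReal_of_nonpos hs.2]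
  have hc := intervalIntegral.continuous_primitive (fun a b => (h0 a).symm.trans (h0 b)) 0
  have : (fun t : ℝ => semigroup P t.toNNReal f η)
      = fun t => f η + ∫ s in (0 : ℝ)..(max t 0), h s := funext fun t => by
    rw [(hP.equation L f hf t.toNNReal η).2, Real.coe_toNNReal']
  rw [this]
  exact continuous_const.add (hc.comp (continuous_id.max continuous_const))

/-- On a finite configuration the generator series is dominated, uniformly in time, by the summable
jump rates. This continuity is what allows the integral equation to be differentiated. -/
theorem IsTransitionSemigroup.continuous_generator (hP : IsTransitionSemigroup P) {L B : ℝ}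
    {f : M.State → ℝ} (hf : IsLip L f) (hB : ∀ ξ, |f ξ| ≤ B) {N : ℕ} {η : M.State}
    (hη : AtMost N η) : Continuous fun s : ℝ => generator (semigroup P s.toNNReal f) η := by
  refine continuous_tsum (f := fun e s => genTerm (semigroup P (Real.toNNReal s) f) η e)
    (fun e => ?_) (hη.summable_rate.mul_right (2 * B))
    (fun e s => abs_genTerm_le (hP.abs_semigroup_le hB _) η e)
  exact continuous_finsetSum _ fun k _ => continuous_const.mul
    ((hP.continuous_semigroup hf _).sub (hP.continuous_semigroup hf _))

theorem IsTransitionSemigroup.hasDerivWithinAt (hP : IsTransitionSemigroup P) {L B : ℝ}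
    {f : M.State → ℝ} (hf : IsLip L f) (hB : ∀ ξ, |f ξ| ≤ B) {N : ℕ} {η : M.State}
    (hη : AtMost N η) {t : ℝ} (ht : 0 ≤ t) :
    HasDerivWithinAt (fun t : ℝ => semigroup P t.toNNReal f η)
      (generator (semigroup P t.toNNReal f) η) (Set.Ici t) t := by
  have h := ((hP.continuous_generator hf hB hη).integral_hasStrictDerivAt 0 t).hasDerivAt.const_add
    (f η)
  have he : ∀ s, 0 ≤ s → semigroup P s.toNNReal f η
      = f η + ∫ s in (0 : ℝ)..s, generator (semigroup P s.toNNReal f) η := fun s hs => by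
    simpa [hs] using (hP.equation L f hf s.toNNReal η).2
  exact h.hasDerivWithinAt.congr (fun s hs => he s (ht.trans hs)) (he t ht)

/-! ### Sufficiency -/

theorem TailCondition.semigroup_le_addAt_one (hM : M.TailCondition)
    (hP : IsTransitionSemigroup P) {L B : ℝ} {f : M.State → ℝ} (hf : IsLip L f)
    (hB : ∀ ξ, |f ξ| ≤ B) (hmono : Monotone f) {N : ℕ} {η : M.State} (hη : AtMost N η) (z : X)
    (t : ℝ≥0) : semigroup P t f η ≤ semigroup P t f (addAt η z 1) := by
  obtain ⟨R, hR⟩ := exists_rate_bound (M := M) (N + 1)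
  have hR0 : 0 ≤ R := (tsum_nonneg (rate_nonneg η η)).trans
    (hR η η (hη.mono N.le_succ) (hη.mono N.le_succ)).2
  have hB0 : 0 ≤ B := (abs_nonneg _).trans (hB η)
  have hS := fun (s : ℝ) => hP.abs_semigroup_le hB s.toNNReal
  -- The infimum of the increments over all finite configurations need not be attained, so no
  -- minimum principle applies directly. Instead the trivial bound coming from |S(t)f| ≤ B is halved
  -- repeatedly.
  have step : ∀ n : ℕ, ∀ s : ℝ, 0 ≤ s → ∀ ξ w, AtMost N ξ →
      -((2 * B + 1) / 2 ^ n * Real.exp ((R + 1) * s))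
        ≤ semigroup P s.toNNReal f (addAt ξ w 1) - semigroup P s.toNNReal f ξ := by
    intro n
    induction n with
    | zero =>
      intro s hs ξ w _
      have h1 : 1 ≤ Real.exp ((R + 1) * s) := Real.one_le_exp (by positivity)
      have h2 := abs_le.1 (hS s ξ)
      have h3 := abs_le.1 (hS s (addAt ξ w 1))
      simp only [pow_zero, div_one]
      nlinarith
    | succ n ih =>
      intro T hT ξ w hξ
      set ε := (2 * B + 1) / 2 ^ (n + 1) with hε
      have hε0 : 0 < ε := by positivity
      have h2ε : (2 * B + 1) / 2 ^ n = 2 * ε := by rw [hε, pow_succ]; field_simp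
      rw [h2ε] at ih
      have key := image_le_of_deriv_right_lt_deriv_boundary (a := 0) (b := T)
        (f := fun s : ℝ => semigroup P s.toNNReal f ξ - semigroup P s.toNNReal f (addAt ξ w 1))
        (f' := fun s => generator (semigroup P s.toNNReal f) ξ
          - generator (semigroup P s.toNNReal f) (addAt ξ w 1))
        (B := fun s => ε * Real.exp ((R + 1) * s))
        (B' := fun s => ε * (Real.exp ((R + 1) * s) * (R + 1)))
        ((hP.continuous_semigroup hf _).sub (hP.continuous_semigroup hf _)).continuousOn
        (fun s hs => (hP.hasDerivWithinAt hf hB hξ hs.1).sub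
          (hP.hasDerivWithinAt hf hB (hξ.addAt w 1) hs.1))
        (by
          simp only [Real.toNNReal_zero, hP.semigroup_zero hf, mul_zero, Real.exp_zero, mul_one]
          linarith [hmono (le_addAt ξ w 1)])
        (fun s => by
          have := (((hasDerivAt_id s).const_mul (R + 1)).exp).const_mul ε
          simpa using this)
        -- At a contact time the increment is `-ε * exp ((R + 1) * s)`, while every increment is at
        -- least twice this. The generator inequality then bounds the derivative by `R * ε * exp ((R
        -- + 1) * s)`, strictly below the slope of the barrier.
        (fun s hs heq => by
          have hg := hM.generator_sub (hS s) (ih s hs.1) hR hξ w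
          have hpos : 0 < ε * Real.exp ((R + 1) * s) := by positivity
          have hu : semigroup P s.toNNReal f (addAt ξ w 1) - semigroup P s.toNNReal f ξ
              + 2 * ε * Real.exp ((R + 1) * s) = ε * Real.exp ((R + 1) * s) := by
            linarith
          rw [hu] at hg
          nlinarith)
      have := key (Set.right_mem_Icc.2 hT)
      beta_reduce at this
      linarith
  have hlim : Tendsto (fun n : ℕ => -((2 * B + 1) / 2 ^ n * Real.exp ((R + 1) * t)))
      atTop (𝓝 (-(0 * Real.exp ((R + 1) * t)))) := by
    refine (Tendsto.mul_const _ ?_).neg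
    exact tendsto_const_nhds.div_atTop (tendsto_pow_atTop_atTop_of_one_lt one_lt_two)
  have := le_of_tendsto' hlim fun n => step n t t.2 η z hη
  simp only [zero_mul, neg_zero, Real.toNNReal_coe] at this
  linarith

/-! ### Passage from finite configurations to the whole state space -/

/-- The configuration which agrees with `ζ` on `F` and with `η` off `F`. -/
noncomputable def splice (F : Finset X) (η ζ : M.State) : M.State :=
  ⟨fun x => if x ∈ F then ζ.1 x else η.1 x, by
    refine Summable.of_nonneg_of_le (fun x => mul_nonneg (Nat.cast_nonneg _) (M.a_pos x).le)
      (fun x => ?_) (η.2.add ζ.2)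
    rw [← add_mul]
    refine mul_le_mul_of_nonneg_right ?_ (M.a_pos x).le
    norm_cast
    beta_reduce
    split_ifs <;> omega⟩

theorem splice_apply (F : Finset X) (η ζ : M.State) (x : X) :
    (splice F η ζ).1 x = if x ∈ F then ζ.1 x else η.1 x := rfl

theorem splice_insert {F : Finset X} {z : X} (hz : z ∉ F) {η ζ : M.State} (h : η ≤ ζ) :
    splice (insert z F) η ζ = addAt (splice F η ζ) z (ζ.1 z - η.1 z) := by
  refine Subtype.ext (funext fun x => ?_)
  simp only [splice_apply, addAt_apply, mem_insert]
  by_cases hx : x = z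
  · subst hx
    have : η.1 x ≤ ζ.1 x := h x
    simp [hz, this]
  · simp [hx]

/-- The configuration without particles. -/
noncomputable def empty : M.State := ⟨fun _ => 0, by simp⟩

theorem empty_apply (x : X) : (empty : M.State).1 x = 0 := rfl

theorem atMost_splice_empty (F : Finset X) (η : M.State) :
    AtMost (∑ x ∈ F, η.1 x) (splice F empty η) := fun G => by
  simp only [splice_apply, empty_apply, ← sum_filter]
  exact sum_le_sum_of_subset fun x hx => (mem_filter.1 hx).2

theorem tendsto_splice_empty (η : M.State) :
    Tendsto (fun F => splice F empty η) atTop (𝓝 η) := by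
  rw [tendsto_iff_dist_tendsto_zero]
  have h := tendsto_tsum_of_dominated_convergence (𝓕 := atTop)
    (bound := fun x => (η.1 x : ℝ) * M.a x)
    
    (f := fun (F : Finset X) x => |((splice F empty η).1 x : ℝ) - (η.1 x : ℝ)| * M.a x)
    (g := fun _ => 0) η.2
    (fun x => by
      refine tendsto_const_nhds.congr' ?_
      filter_upwards [eventually_ge_atTop {x}] with F hF
      simp [splice_apply, singleton_subset_iff.1 hF])
    (Eventually.of_forall fun F x => by
      have := M.a_pos x
      rw [Real.norm_of_nonneg (by positivity)]
      refine mul_le_mul_of_nonneg_right ?_ this.le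
      rw [splice_apply]
      split_ifs <;> simp [empty_apply])
  rwa [tsum_zero] at h

theorem IsLip.continuous {L : ℝ} {f : M.State → ℝ} (hf : IsLip L f) : Continuous f :=
  (LipschitzWith.of_dist_le_mul (K := L.toNNReal) fun η ζ => (hf η ζ).trans
    (mul_le_mul_of_nonneg_right (Real.le_coe_toNNReal L) dist_nonneg)).continuous

/-- A continuous function which increases when a particle is added to a finite configuration is
monotone. -/
theorem monotone_of_le_addAt_one {u : M.State → ℝ} (hu : Continuous u)
    (h : ∀ N η z, AtMost N η → u η ≤ u (addAt η z 1)) : Monotone u := by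
  have h1 : ∀ (n N : ℕ) η z, AtMost N η → u η ≤ u (addAt η z n) := by
    intro n N η z hη
    induction n with
    | zero => rw [addAt_zero]
    | succ n ih => rw [addAt_succ]; exact ih.trans (h _ _ z (hη.addAt z n))
  have h2 : ∀ (F : Finset X) (N : ℕ) (η ζ : M.State), AtMost N η → η ≤ ζ →
      u η ≤ u (splice F η ζ) ∧ ∃ N', AtMost N' (splice F η ζ) := by
    intro F N η ζ hη hle
    induction F using Finset.induction_on with
    | empty =>
      have : splice ∅ η ζ = η := Subtype.ext (funext fun x => by simp [splice_apply])
      rw [this]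
      exact ⟨le_rfl, N, hη⟩
    | insert z F hz ih =>
      obtain ⟨ih1, N', hN'⟩ := ih
      rw [splice_insert hz hle]
      exact ⟨ih1.trans (h1 _ N' _ z hN'), _, hN'.addAt z _⟩
  intro η ζ hle
  refine le_of_tendsto_of_tendsto' ((hu.tendsto η).comp (tendsto_splice_empty η))
    ((hu.tendsto ζ).comp (tendsto_splice_empty ζ)) fun F => ?_
  have hle' : splice F empty η ≤ splice F empty ζ := fun x => by
    change (splice F empty η).1 x ≤ (splice F empty ζ).1 x
    rw [splice_apply, splice_apply]
    split_ifs
    exacts [hle x, le_rfl]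
  have := (h2 F _ _ _ (atMost_splice_empty F η) hle').1
  -- Both truncations vanish off `F`, so splicing the larger into the smaller on `F` recovers the
  -- larger.
  have he : splice F (splice F empty η) (splice F empty ζ) = splice F empty ζ :=
    Subtype.ext (funext fun x => by simp only [splice_apply]; split_ifs <;> rfl)
  rwa [he] at this

theorem TailCondition.monotone_semigroup (hM : M.TailCondition) (hP : IsTransitionSemigroup P)
    {L B : ℝ} {f : M.State → ℝ} (hf : IsLip L f) (hB : ∀ ξ, |f ξ| ≤ B) (hmono : Monotone f)
    (t : ℝ≥0) : Monotone (semigroup P t f) := by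
  obtain ⟨c, hc⟩ := hP.lipschitz
  exact monotone_of_le_addAt_one (hc L f hf t).continuous
    fun N η z hη => hM.semigroup_le_addAt_one hP hf hB hmono hη z t

/-! ### Lipschitz approximation -/

/-- The infimal convolution of `f` with `n` times the distance. -/
noncomputable def lipApprox (f : M.State → ℝ) (n : ℕ) (η : M.State) : ℝ :=
  ⨅ ξ, (f ξ + n * dist η ξ)

section lipApprox

variable {f : M.State → ℝ} {B : ℝ}

theorem lipApprox_le (hB : ∀ ξ, |f ξ| ≤ B) (n : ℕ) (η ξ : M.State) :
    lipApprox f n η ≤ f ξ + n * dist η ξ := by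
  refine ciInf_le ⟨-B, ?_⟩ ξ
  rintro _ ⟨ζ, rfl⟩
  have : (0 : ℝ) ≤ n * dist η ζ := by positivity
  linarith [(abs_le.1 (hB ζ)).1]

theorem le_lipApprox {c : ℝ} {n : ℕ} {η : M.State} (h : ∀ ξ, c ≤ f ξ + n * dist η ξ) :
    c ≤ lipApprox f n η :=
  have : Nonempty M.State := ⟨η⟩
  le_ciInf h

theorem abs_lipApprox_le (hB : ∀ ξ, |f ξ| ≤ B) (n : ℕ) (η : M.State) : |lipApprox f n η| ≤ B := by
  refine abs_le.2 ⟨le_lipApprox fun ξ => ?_, ?_⟩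
  · have : (0 : ℝ) ≤ n * dist η ξ := by positivity
    linarith [(abs_le.1 (hB ξ)).1]
  · have := lipApprox_le hB n η η
    rw [dist_self] at this
    linarith [(abs_le.1 (hB η)).2]

theorem isLip_lipApprox (hB : ∀ ξ, |f ξ| ≤ B) (n : ℕ) : IsLip n (lipApprox f n) := by
  have h : ∀ η ζ : M.State, lipApprox f n η - n * dist η ζ ≤ lipApprox f n ζ := fun η ζ =>
    le_lipApprox fun ξ => by
      have h1 := lipApprox_le hB n η ξ
      have h2 := mul_le_mul_of_nonneg_left (dist_triangle η ζ ξ) (Nat.cast_nonneg (α := ℝ) n)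
      linarith
  intro η ζ
  have h1 := h η ζ
  have h2 := h ζ η
  rw [dist_comm] at h2
  exact abs_le.2 ⟨by linarith, by linarith⟩

theorem tendsto_lipApprox (hB : ∀ ξ, |f ξ| ≤ B) (hf : Continuous f) (η : M.State) :
    Tendsto (fun n => lipApprox f n η) atTop (𝓝 (f η)) := by
  refine tendsto_order.2 ⟨fun c hc => ?_, fun c hc => Eventually.of_forall fun n => ?_⟩
  · obtain ⟨c', hc1, hc2⟩ := exists_between hc
    obtain ⟨δ, hδ, hball⟩ := Metric.eventually_nhds_iff.1 ((hf.tendsto η).eventually_const_lt hc2)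
    obtain ⟨n₀, hn₀⟩ := exists_nat_gt (2 * B / δ)
    filter_upwards [eventually_ge_atTop n₀] with n hn
    refine hc1.trans_le (le_lipApprox fun ξ => ?_)
    have hnd : (0 : ℝ) ≤ n * dist η ξ := by positivity
    rcases lt_or_ge (dist ξ η) δ with hd | hd
    · linarith [hball hd]
    · have h1 : 2 * B < n₀ * δ := (div_lt_iff₀ hδ).1 hn₀
      have h2 : (n₀ : ℝ) * δ ≤ n * dist η ξ := by
        rw [dist_comm]
        exact mul_le_mul (by exact_mod_cast hn) hd hδ.le (Nat.cast_nonneg _)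
      linarith [(abs_le.1 (hB ξ)).1, (abs_le.1 (hB η)).2]
  · have := lipApprox_le hB n η η
    rw [dist_self] at this
    linarith

/-- A competitor `ξ` for `ζ` is replaced by `min η ξ`: this lowers `f`, and since `η ≤ ζ` it is no
farther from `η` than `ξ` is from `ζ`. -/
theorem monotone_lipApprox (hB : ∀ ξ, |f ξ| ≤ B) (hf : Monotone f) (n : ℕ) :
    Monotone (lipApprox f n) := by
  intro η ζ hle
  refine le_lipApprox fun ξ => ?_
  let ξ' : M.State := ⟨fun x => min (η.1 x) (ξ.1 x), by
    refine Summable.of_nonneg_of_le (fun x => mul_nonneg (Nat.cast_nonneg _) (M.a_pos x).le)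
      (fun x => ?_) η.2
    exact mul_le_mul_of_nonneg_right (by exact_mod_cast min_le_left _ _) (M.a_pos x).le⟩
  have h1 : f ξ' ≤ f ξ := hf fun x => min_le_right (η.1 x) (ξ.1 x)
  have h2 : dist η ξ' ≤ dist ζ ξ := by
    refine (summable_absDiff η ξ').tsum_le_tsum (fun x => ?_) (summable_absDiff ζ ξ)
    refine mul_le_mul_of_nonneg_right ?_ (M.a_pos x).le
    have hx : (η.1 x : ℝ) ≤ ζ.1 x := by exact_mod_cast hle x
    change |(η.1 x : ℝ) - ((min (η.1 x) (ξ.1 x) : ℕ) : ℝ)| ≤ _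
    rw [Nat.cast_min]
    rcases le_total (η.1 x : ℝ) (ξ.1 x) with h | h
    · simp [min_eq_left h]
    · rw [min_eq_right h, abs_of_nonneg (by linarith)]
      exact le_trans (by linarith) (le_abs_self _)
  have h3 := lipApprox_le hB n η ξ'
  have h4 := mul_le_mul_of_nonneg_left h2 (Nat.cast_nonneg (α := ℝ) n)
  linarith

theorem IsTransitionSemigroup.tendsto_semigroup_lipApprox (hP : IsTransitionSemigroup P)
    (hB : ∀ ξ, |f ξ| ≤ B) (hf : Continuous f) (t : ℝ≥0) (η : M.State) :
    Tendsto (fun n => semigroup P t (lipApprox f n) η) atTop (𝓝 (semigroup P t f η)) := by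
  have := hP.markov t
  refine tendsto_integral_of_dominated_convergence (fun _ => B)
    (fun n => (isLip_lipApprox hB n).continuous.aestronglyMeasurable) (integrable_const B)
    (fun n => Eventually.of_forall (abs_lipApprox_le hB n))
    (Eventually.of_forall (tendsto_lipApprox hB hf))

end lipApprox

/-- The Feller property. -/
theorem IsTransitionSemigroup.continuous_semigroup_state (hP : IsTransitionSemigroup P)
    {f : M.State → ℝ} {B : ℝ} (hB : ∀ ξ, |f ξ| ≤ B) (hf : Continuous f) (t : ℝ≥0) :
    Continuous (semigroup P t f) := by
  have := hP.markov t
  obtain ⟨c, hc⟩ := hP.lipschitz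
  refine continuous_iff_continuousAt.2 fun η => ?_
  let Q : M.State → ProbabilityMeasure M.State := fun ξ => ⟨P t ξ, inferInstance⟩
  have hw : Tendsto Q (𝓝 η) (𝓝 (Q η)) := by
    -- Weak convergence of the laws may be tested on bounded Lipschitz functions, on which the
    -- semigroup is Lipschitz by assumption.
    refine tendsto_iff_forall_lipschitz_integral_tendsto.2 fun g _ ⟨L, hL⟩ => ?_
    have hg : IsLip L g := fun ξ ζ => hL.dist_le_mul ξ ζ
    exact (hc L g hg t).continuous.tendsto η
  exact ProbabilityMeasure.tendsto_iff_forall_integral_tendsto.1 hw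
    (BoundedContinuousFunction.ofNormedAddCommGroup f hf B hB)

theorem TailCondition.attractive (hM : M.TailCondition) (hP : IsTransitionSemigroup P) :
    Attractive P := by
  rintro f ⟨B, hB⟩ hmono hf t _
  refine ⟨⟨B, hP.abs_semigroup_le hB t⟩, fun η ζ hle => ?_, hP.continuous_semigroup_state hB hf t⟩
  exact le_of_tendsto_of_tendsto' (hP.tendsto_semigroup_lipApprox hB hf t η)
    (hP.tendsto_semigroup_lipApprox hB hf t ζ) fun n =>
      hM.monotone_semigroup hP (isLip_lipApprox hB n) (abs_lipApprox_le hB n)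
        (monotone_lipApprox hB hmono n) t hle

/-! ### Necessity -/

/-- Equality of `f` at the two configurations makes the difference of the semigroup vanish at time 0
and be nonnegative afterwards, so its right derivative at 0 is nonnegative. -/
theorem Attractive.generator_le (hA : Attractive P) (hP : IsTransitionSemigroup P) {L B : ℝ}
    {f : M.State → ℝ} (hf : IsLip L f) (hB : ∀ ξ, |f ξ| ≤ B) (hmono : Monotone f) {N : ℕ}
    {η ζ : M.State} (hη : AtMost N η) (hζ : AtMost N ζ) (hle : η ≤ ζ) (heq : f η = f ζ) :
    generator f η ≤ generator f ζ := by
  have hd := ((hP.hasDerivWithinAt hf hB hζ le_rfl).sub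
    (hP.hasDerivWithinAt hf hB hη le_rfl)).Ioi_of_Ici
  rw [hasDerivWithinAt_iff_tendsto_slope' (by simp)] at hd
  have h0 : semigroup P 0 f = f := funext (hP.semigroup_zero hf)
  rw [Real.toNNReal_zero, h0] at hd
  refine sub_nonneg.1 (ge_of_tendsto hd ?_)
  filter_upwards [self_mem_nhdsWithin] with t ht
  have ht : (0 : ℝ) < t := ht
  have hm := (hA f ⟨B, hB⟩ hmono hf.continuous t.toNNReal (Real.toNNReal_pos.2 ht)).2.1 hle
  rw [slope_def_field]
  simp only [Pi.sub_apply, Real.toNNReal_zero, h0, heq, sub_self, sub_zero]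
  exact div_nonneg (sub_nonneg.2 hm) ht.le

/-- A function with oscillation at most one which depends on finitely many coordinates is
Lipschitz. -/
theorem isLip_of_local (G : Finset X) {f : M.State → ℝ} (h1 : ∀ η ζ, |f η - f ζ| ≤ 1)
    (hG : ∀ η ζ : M.State, (∀ x ∈ G, η.1 x = ζ.1 x) → f η = f ζ) :
    IsLip (∑ x ∈ G, (M.a x)⁻¹) f := by
  intro η ζ
  have hpos : ∀ x ∈ G, 0 ≤ (M.a x)⁻¹ := fun x _ => (inv_pos.2 (M.a_pos x)).le
  by_cases h : ∀ x ∈ G, η.1 x = ζ.1 x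
  · rw [hG η ζ h, sub_self, abs_zero]
    exact mul_nonneg (sum_nonneg hpos) dist_nonneg
  · push Not at h
    obtain ⟨x, hx, hne⟩ := h
    have hd : M.a x ≤ dist η ζ := by
      refine le_trans ?_ ((summable_absDiff η ζ).le_tsum x
        fun z _ => mul_nonneg (abs_nonneg _) (M.a_pos z).le)
      have : (1 : ℝ) ≤ |(η.1 x : ℝ) - ζ.1 x| := by
        have : (1 : ℤ) ≤ |(η.1 x : ℤ) - ζ.1 x| := Int.one_le_abs (by omega)
        exact_mod_cast this
      exact le_mul_of_one_le_left (M.a_pos x).le this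
    calc |f η - f ζ| ≤ 1 := h1 η ζ
      _ = (M.a x)⁻¹ * M.a x := (inv_mul_cancel₀ (M.a_pos x).ne').symm
      _ ≤ (∑ x ∈ G, (M.a x)⁻¹) * dist η ζ :=
        mul_le_mul (single_le_sum hpos hx) hd (M.a_pos x).le (sum_nonneg hpos)

/-- The configuration with `α` particles at `x` and `β` at `y`. -/
noncomputable def pair (M : MassMigration X) (x y : X) (α β : ℕ) : M.State :=
  addAt (addAt empty x α) y β

section pair

variable {x y : X} {α β : ℕ}

theorem pair_apply (z : X) :
    (pair M x y α β).1 z = (if z = x then α else 0) + if z = y then β else 0 := by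
  simp [pair, addAt_apply, empty_apply]

theorem pair_left (hxy : x ≠ y) : (pair M x y α β).1 x = α := by simp [pair_apply, hxy]

theorem pair_right (hxy : x ≠ y) : (pair M x y α β).1 y = β := by simp [pair_apply, hxy.symm]

theorem pair_of_ne {z : X} (hx : z ≠ x) (hy : z ≠ y) : (pair M x y α β).1 z = 0 := by
  simp [pair_apply, hx, hy]

theorem pair_mono {α' β' : ℕ} (hα : α ≤ α') (hβ : β ≤ β') :
    pair M x y α β ≤ pair M x y α' β' := fun z => by
  change (pair M x y α β).1 z ≤ (pair M x y α' β').1 z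
  rw [pair_apply, pair_apply]
  split_ifs <;> omega

theorem atMost_pair {N : ℕ} (h : α + β ≤ N) : AtMost N (pair M x y α β) := by
  have h0 : AtMost 0 (empty : M.State) := fun F => by simp [empty_apply]
  exact ((h0.addAt x α).addAt y β).mono (by omega)

theorem tail_eq_sum_ite (k α β : ℕ) :
    M.tail k α β = ∑ k' ∈ Icc 1 α, M.g k' α β * if k < k' then 1 else 0 := by
  simp only [mul_ite, mul_one, mul_zero, ← sum_filter]
  refine sum_congr (Finset.ext fun k' => ?_) fun _ _ => rfl
  simp only [mem_Ioc, mem_filter, mem_Icc]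
  omega

/-- The indicator function of the presence of at least `n` particles at `y`. -/
noncomputable def gainTest (M : MassMigration X) (y : X) (n : ℕ) (η : M.State) : ℝ :=
  if n ≤ η.1 y then 1 else 0

/-- Only `x` and `y` are occupied, so no edge other than `(x, y)` can bring particles to `y`; along
it the test switches on when more than `k` particles move. -/
theorem generator_gainTest (hxy : x ≠ y) (k : ℕ) :
    generator (gainTest M y (β + k + 1)) (pair M x y α β) = M.p x y * M.tail k α β := by
  have hl := pair_left (M := M) (α := α) (β := β) hxy
  have hr := pair_right (M := M) (α := α) (β := β) hxy
  have h0 : gainTest M y (β + k + 1) (pair M x y α β) = 0 := by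
    rw [gainTest, hr, if_neg (by omega)]
  have hsingle : ∀ e, e ≠ (x, y) →
      genTerm (gainTest M y (β + k + 1)) (pair M x y α β) e = 0 := by
    rintro ⟨u, v⟩ huv
    refine sum_eq_zero fun k' hk' => mul_eq_zero_of_right _ ?_
    obtain ⟨hk1, hk2⟩ := mem_Icc.1 hk'
    dsimp only at hk2 ⊢
    by_cases huv' : u = v
    · rw [huv', jump_self, sub_self]
    rw [h0, sub_zero, gainTest, if_neg]
    rw [jump_apply _ _ _ hk2, hr]
    by_cases hv : v = y
    · subst hv
      have hux : u ≠ x := fun h => huv (by rw [h])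
      rw [pair_of_ne hux huv'] at hk2
      omega
    · rw [if_neg (Ne.symm hv)]
      split_ifs <;> omega
  refine (tsum_eq_single (x, y) hsingle).trans ?_
  rw [tail_eq_sum_ite, mul_sum]
  simp only [genTerm, hl, hr, h0, sub_zero, mul_assoc]
  refine sum_congr rfl fun k' hk' => ?_
  have hk2 : k' ≤ (pair M x y α β).1 x := hl.symm ▸ (mem_Icc.1 hk').2
  congr 2
  rw [gainTest, jump_apply _ _ _ hk2, hr, if_neg hxy.symm, if_pos rfl]
  refine if_congr ?_ rfl rfl
  omega

/-- The indicator function of the presence of at least `n` particles at `x`, or of particles in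
`F` away from `x` and `y`. -/
noncomputable def lossTest (M : MassMigration X) (x y : X) (n : ℕ) (F : Finset X)
    (η : M.State) : ℝ :=
  if n ≤ η.1 x ∨ ∃ z ∈ F, z ≠ x ∧ z ≠ y ∧ 1 ≤ η.1 z then 1 else 0

theorem abs_lossTest_le (n : ℕ) (F : Finset X) (η : M.State) : |lossTest M x y n F η| ≤ 1 := by
  unfold lossTest; split_ifs <;> simp

/-- Particles leaving `x` for a third site in `F` keep the test equal to 1, so in the limit only
losses along `(x, y)` count. A finite `F` keeps the test function Lipschitz; dominated convergence
removes the jumps to sites outside `F`. -/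
theorem tendsto_generator_lossTest (hxy : x ≠ y) {n k : ℕ} (hn : n + k = α) :
    Tendsto (fun F => generator (lossTest M x y n F) (pair M x y α β)) atTop
      (𝓝 (-(M.p x y * M.tail k α β))) := by
  have hl := pair_left (M := M) (α := α) (β := β) hxy
  have hr := pair_right (M := M) (α := α) (β := β) hxy
  have h1 : ∀ F, lossTest M x y n F (pair M x y α β) = 1 := fun F => by
    rw [lossTest, hl, if_pos (Or.inl (by omega))]
  have hlim := tendsto_tsum_of_dominated_convergence (𝓕 := atTop)
    (f := fun (F : Finset X) e => genTerm (lossTest M x y n F) (pair M x y α β) e)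
    (g := fun e => if e = (x, y) then -(M.p x y * M.tail k α β) else 0)
    ((atMost_pair (le_refl (α + β))).summable_rate.mul_right (2 * 1))
    (fun e => ?_)
    (Eventually.of_forall fun F e => abs_genTerm_le (abs_lossTest_le n F) (pair M x y α β) e)
  · rwa [tsum_ite_eq] at hlim
  obtain ⟨u, v⟩ := e
  refine tendsto_const_nhds.congr' ?_
  filter_upwards [eventually_ge_atTop {v}] with F hF
  have hvF : v ∈ F := singleton_subset_iff.1 hF
  split_ifs with he
  · obtain ⟨rfl, rfl⟩ := Prod.mk.inj he
    rw [tail_eq_sum_ite, mul_sum, ← sum_neg_distrib]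
    simp only [genTerm, hl, hr, h1, mul_assoc, ← mul_neg]
    refine sum_congr rfl fun k' hk' => ?_
    have hk2 : k' ≤ (pair M u v α β).1 u := hl.symm ▸ (mem_Icc.1 hk').2
    congr 2
    have hiff : (n ≤ (jump (pair M u v α β) u v k').1 u ∨
        ∃ z ∈ F, z ≠ u ∧ z ≠ v ∧ 1 ≤ (jump (pair M u v α β) u v k').1 z) ↔ ¬ k < k' := by
      constructor
      · rintro (h | ⟨z, -, hzu, hzv, hz⟩)
        · rw [jump_apply _ _ _ hk2, hl, if_pos rfl, if_neg hxy] at h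
          rw [hl] at hk2
          omega
        · rw [jump_apply _ _ _ hk2, if_neg hzu, if_neg hzv, pair_of_ne hzu hzv] at hz
          omega
      · intro h
        left
        rw [jump_apply _ _ _ hk2, hl, if_pos rfl, if_neg hxy]
        omega
    rw [lossTest, if_congr hiff rfl rfl]
    split_ifs <;> simp
  · refine (sum_eq_zero fun k' hk' => mul_eq_zero_of_right _ ?_).symm
    obtain ⟨hk1, hk2⟩ := mem_Icc.1 hk'
    dsimp only at hk2 ⊢
    by_cases huv : u = v
    · rw [huv, jump_self, sub_self]
    rw [h1, sub_eq_zero, lossTest, if_pos]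
    by_cases hu : u = x
    · have hvx : v ≠ x := fun h => huv (hu.trans h.symm)
      have hvy : v ≠ y := fun h => he (by rw [hu, h])
      refine Or.inr ⟨v, hvF, hvx, hvy, ?_⟩
      rw [jump_apply _ _ _ hk2, if_pos rfl]
      omega
    · left
      rw [jump_apply _ _ _ hk2, hl, if_neg (Ne.symm hu)]
      omega

end pair

/-- The necessity argument needs an edge between distinct sites, since jumps from a site to itself
do nothing. Without such an edge no other site could be reached. -/
theorem exists_ne_p_pos [Nontrivial X] (M : MassMigration X) : ∃ x y, x ≠ y ∧ 0 < M.p x y := by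
  obtain ⟨x, y, hxy⟩ := exists_pair_ne X
  by_contra! h
  have hc : ∀ z, Relation.ReflTransGen (fun u v => 0 < M.p u v) x z → x = z := fun z hz => by
    induction hz with
    | refl => rfl
    | tail _ hstep ih =>
      refine ih.trans ?_
      by_contra hne
      exact (h _ _ hne).not_gt hstep
  exact hxy (hc y (M.p_irreducible x y))

theorem Attractive.gain_le (hA : Attractive P) (hP : IsTransitionSemigroup P) {x y : X}
    (hxy : x ≠ y) (hp : 0 < M.p x y) {α β α' β' k k' : ℕ} (hα : α ≤ α') (hβ : β ≤ β')
    (hk : β + k = β' + k') : M.tail k α β ≤ M.tail k' α' β' := by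
  have hB : ∀ ξ : M.State, |gainTest M y (β + k + 1) ξ| ≤ 1 := fun ξ => by
    unfold gainTest; split_ifs <;> simp
  have hf := isLip_of_local (M := M) {y} (f := gainTest M y (β + k + 1))
    (fun η ζ => by unfold gainTest; split_ifs <;> simp)
    (fun η ζ h => by rw [gainTest, gainTest, h y (mem_singleton_self y)])
  have hmono : Monotone (gainTest M y (β + k + 1)) := fun η ζ hle => by
    have : η.1 y ≤ ζ.1 y := hle y
    unfold gainTest
    split_ifs <;> first | omega | simp
  have h := hA.generator_le hP hf hB hmono (N := α' + β') (atMost_pair (by omega))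
    (atMost_pair le_rfl) (pair_mono (x := x) (y := y) hα hβ) (by
      rw [gainTest, gainTest, pair_right hxy, pair_right hxy, if_neg (by omega),
        if_neg (by omega)])
  rw [generator_gainTest hxy] at h
  rw [hk, generator_gainTest hxy] at h
  exact le_of_mul_le_mul_left h hp

theorem Attractive.loss_le (hA : Attractive P) (hP : IsTransitionSemigroup P) {x y : X}
    (hxy : x ≠ y) (hp : 0 < M.p x y) {α β α' β' n k k' : ℕ} (hα : α ≤ α') (hβ : β ≤ β')
    (hk : n + k = α) (hk' : n + k' = α') : M.tail k' α' β' ≤ M.tail k α β := by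
  have hlim := le_of_tendsto_of_tendsto'
    (tendsto_generator_lossTest (M := M) (β := β) hxy hk)
    (tendsto_generator_lossTest (M := M) (β := β') hxy hk') fun F => by
      have hf := isLip_of_local (M := M) (insert x F) (f := lossTest M x y n F)
        (fun η ζ => by unfold lossTest; split_ifs <;> simp)
        (fun η ζ h => by
          unfold lossTest
          refine if_congr (or_congr (by rw [h x (mem_insert_self x F)])
            (exists_congr fun z => and_congr_right fun hz => ?_)) rfl rfl
          rw [h z (mem_insert_of_mem hz)])
      have hmono : Monotone (lossTest M x y n F) := fun η ζ hle => by
        unfold lossTest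
        split_ifs with h1 h2
        · rfl
        · refine absurd ?_ h2
          rcases h1 with h1 | ⟨z, hz, hzx, hzy, h1⟩
          · exact Or.inl (h1.trans (hle x))
          · exact Or.inr ⟨z, hz, hzx, hzy, h1.trans (hle z)⟩
        · exact zero_le_one
        · rfl
      refine hA.generator_le hP hf (abs_lossTest_le n F) hmono (N := α' + β')
        (atMost_pair (by omega)) (atMost_pair le_rfl) (pair_mono hα hβ) ?_
      rw [lossTest, lossTest, pair_left hxy, pair_left hxy, if_pos (Or.inl (by omega)),
        if_pos (Or.inl (by omega))]
  exact le_of_mul_le_mul_left (neg_le_neg_iff.1 hlim) hp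

theorem attractive_iff [Nontrivial X] (hP : IsTransitionSemigroup P) :
    Attractive P ↔ M.TailCondition := by
  refine ⟨fun hA => ?_, fun hM => hM.attractive hP⟩
  obtain ⟨x, y, hxy, hp⟩ := M.exists_ne_p_pos
  intro α β k _
  refine ⟨⟨?_, hA.gain_le hP hxy hp α.le_succ le_rfl rfl⟩,
    hA.gain_le hP hxy hp le_rfl β.le_succ (by omega), ?_⟩
  -- The threshold `α - k` is a true difference only for `k ≤ α`; otherwise both tails are empty.
  · rcases le_total α k with h | h
    · rw [tail_eq_zero _ h, tail_eq_zero _ (by omega)]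
    · exact hA.loss_le hP hxy hp (n := α - k) α.le_succ le_rfl (by omega) (by omega)
  · rcases le_total α k with h | h
    · rw [tail_eq_zero _ h, tail_eq_zero _ h]
    · exact hA.loss_le hP hxy hp (n := α - k) le_rfl β.le_succ (by omega) (by omega)

/-! ### Zero range and target processes -/

theorem IsZeroRange.tail_eq {h : ℕ → ℕ → ℝ} (hh : M.IsZeroRange h) (k α β : ℕ) :
    M.tail k α β = ∑ k' ∈ Ioc k α, h k' α :=
  sum_congr rfl fun k' hk => hh k' α β (by have := mem_Ioc.1 hk; omega) (mem_Ioc.1 hk).2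

theorem IsTarget.tail_eq {h : ℕ → ℕ → ℝ} (hh : M.IsTarget h) (k α β : ℕ) :
    M.tail k α β = ∑ k' ∈ Ioc k α, h k' β :=
  sum_congr rfl fun k' hk => hh k' α β (by have := mem_Ioc.1 hk; omega) (mem_Ioc.1 hk).2

theorem tail_succ_le (k α β : ℕ) : M.tail (k + 1) α β ≤ M.tail k α β :=
  sum_le_sum_of_subset_of_nonneg (Ioc_subset_Ioc_left k.le_succ) fun _ _ _ => M.g_nonneg _ _ _

theorem IsZeroRange.tailCondition_iff {h : ℕ → ℕ → ℝ} (hh : M.IsZeroRange h) :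
    M.TailCondition ↔ ∀ α k : ℕ, 1 ≤ α →
      ∑ k' ∈ Ioc (k + 1) (α + 1), h k' (α + 1) ≤ ∑ k' ∈ Ioc k α, h k' α ∧
      ∑ k' ∈ Ioc k α, h k' α ≤ ∑ k' ∈ Ioc k (α + 1), h k' (α + 1) := by
  constructor
  · intro H α k hα
    simpa only [hh.tail_eq] using (H α 0 k hα).1
  · intro H α β k hα
    refine ⟨by simpa only [hh.tail_eq] using H α k hα, ?_⟩
    have : M.tail k α (β + 1) = M.tail k α β := by rw [hh.tail_eq, hh.tail_eq]
    rw [this]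
    exact ⟨tail_succ_le k α β, le_rfl⟩

theorem sum_Ioc_eq_add {f : ℕ → ℝ} {m n : ℕ} (h : m < n) :
    ∑ k ∈ Ioc m n, f k = f (m + 1) + ∑ k ∈ Ioc (m + 1) n, f k := by
  rw [← sum_Ioc_consecutive f m.le_succ h, Nat.Ioc_succ_singleton, sum_singleton]

theorem sum_range_reflect_eq_sum_Ioc (f : ℕ → ℝ) {m α : ℕ} (hm : m ≤ α) :
    ∑ j ∈ range m, f (α - j) = ∑ k ∈ Ioc (α - m) α, f k := by
  induction m with
  | zero => simp
  | succ m ih =>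
    rw [sum_range_succ, ih (by omega), sum_Ioc_eq_add (by omega : α - (m + 1) < α),
      show α - (m + 1) + 1 = α - m by omega, add_comm]

/-- The substitution `k = α - m` and reversal of the sums match the two forms; the upper bound is
the first term of the longest tail. The cases `k ≥ α`, which have no counterpart in `m`, hold by
nonnegativity of the rates. -/
theorem IsZeroRange.condition_iff {h : ℕ → ℕ → ℝ} (hh : M.IsZeroRange h) :
    (∀ α k : ℕ, 1 ≤ α →
      ∑ k' ∈ Ioc (k + 1) (α + 1), h k' (α + 1) ≤ ∑ k' ∈ Ioc k α, h k' α ∧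
      ∑ k' ∈ Ioc k α, h k' α ≤ ∑ k' ∈ Ioc k (α + 1), h k' (α + 1)) ↔
    ∀ α m : ℕ, 1 ≤ α → 1 ≤ m → m ≤ α →
      0 ≤ ∑ j ∈ range m, (h (α - j) α - h (α + 1 - j) (α + 1)) ∧
      ∑ j ∈ range m, (h (α - j) α - h (α + 1 - j) (α + 1)) ≤ h (α + 1 - m) (α + 1) := by
  have key : ∀ k n : ℕ,
      ((∑ k' ∈ Ioc (k + 1) (k + n + 1), h k' (k + n + 1) ≤ ∑ k' ∈ Ioc k (k + n), h k' (k + n) ∧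
        ∑ k' ∈ Ioc k (k + n), h k' (k + n) ≤ ∑ k' ∈ Ioc k (k + n + 1), h k' (k + n + 1)) ↔
      (0 ≤ ∑ j ∈ range n, (h (k + n - j) (k + n) - h (k + n + 1 - j) (k + n + 1)) ∧
        ∑ j ∈ range n, (h (k + n - j) (k + n) - h (k + n + 1 - j) (k + n + 1))
          ≤ h (k + n + 1 - n) (k + n + 1))) := by
    intro k n
    have e : k + n + 1 - n = k + 1 := by omega
    rw [sum_sub_distrib, sum_range_reflect_eq_sum_Ioc (fun j => h j (k + n)) (Nat.le_add_left n k),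
      sum_range_reflect_eq_sum_Ioc (fun j => h j (k + n + 1)) (by omega : n ≤ k + n + 1), e,
      Nat.add_sub_cancel, sum_Ioc_eq_add (by omega : k < k + n + 1), sub_nonneg, sub_le_iff_le_add]
  constructor
  · intro H α m hα hm hmα
    obtain ⟨k, rfl⟩ := Nat.exists_eq_add_of_le' hmα
    exact (key k m).1 (H _ _ hα)
  · intro H α k hα
    rcases lt_or_ge k α with hk | hk
    · obtain ⟨n, rfl⟩ := Nat.exists_eq_add_of_le hk.le
      exact (key k n).2 (H _ _ hα (by omega) (by omega))
    · rw [Ioc_eq_empty_of_le hk, Ioc_eq_empty_of_le (by omega : α + 1 ≤ k + 1), sum_empty,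
        sum_empty, ← hh.tail_eq k (α + 1) 0]
      exact ⟨le_rfl, tail_nonneg _ _ _⟩

theorem IsTarget.nonneg {h : ℕ → ℕ → ℝ} (hh : M.IsTarget h) {k : ℕ} (hk : 1 ≤ k) (β : ℕ) :
    0 ≤ h k β := by
  rw [← hh k k β hk le_rfl]; exact M.g_nonneg _ _ _

theorem IsTarget.tailCondition_iff {h : ℕ → ℕ → ℝ} (hh : M.IsTarget h) :
    M.TailCondition ↔ ∀ α β k : ℕ, 1 ≤ α →
      (h (α + 1) β ≤ h α β ∧ h α (β + 1) ≤ h α β) ∧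
      ∑ k' ∈ Ioc (k + 1) α, h k' β ≤ ∑ k' ∈ Ioc k α, h k' (β + 1) := by
  constructor
  · intro H α β k hα
    -- With `k = α - 1` the tails in the first and last inequalities reduce to single rates.
    obtain ⟨n, rfl⟩ := Nat.exists_eq_add_of_le' hα
    have h1 := (H (n + 1) β n hα).1.1
    have h2 := (H (n + 1) β n hα).2.2
    have h3 := (H (n + 1) β k hα).2.1
    simp only [hh.tail_eq, Nat.Ioc_succ_singleton, sum_singleton] at h1 h2 h3
    exact ⟨⟨h1, h2⟩, h3⟩
  · intro H α β k hα
    simp only [hh.tail_eq]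
    refine ⟨⟨?_, ?_⟩, (H α β k hα).2, ?_⟩
    -- After shifting the index by one, the comparison holds term by term.
    · rw [← map_add_right_Ioc, sum_map]
      exact sum_le_sum fun k' hk' => (H k' β 0 (by have := mem_Ioc.1 hk'; omega)).1.1
    · exact sum_le_sum_of_subset_of_nonneg (Ioc_subset_Ioc_right α.le_succ)
        fun k' hk' _ => hh.nonneg (by have := mem_Ioc.1 hk'; omega) β
    · exact sum_le_sum fun k' hk' =>
        (H k' β 0 (by have := mem_Ioc.1 hk'; omega)).1.2

end

end MassMigration

theorem lemma4p1 {X : Type*} [Countable X] [Nontrivial X] (M : MassMigration X)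
    (P : ℝ≥0 → Kernel M.State M.State) (hP : MassMigration.IsTransitionSemigroup P) :
    -- general mass migration process
    (MassMigration.Attractive P ↔ ∀ α β k : ℕ, 1 ≤ α →
      (M.tail (k + 1) (α + 1) β ≤ M.tail k α β ∧ M.tail k α β ≤ M.tail k (α + 1) β) ∧
      (M.tail (k + 1) α β ≤ M.tail k α (β + 1) ∧ M.tail k α (β + 1) ≤ M.tail k α β)) ∧
    -- zero range
    (∀ h : ℕ → ℕ → ℝ, M.IsZeroRange h →
      (MassMigration.Attractive P ↔ ∀ α k : ℕ, 1 ≤ α →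
        ∑ k' ∈ Finset.Ioc (k + 1) (α + 1), h k' (α + 1) ≤ ∑ k' ∈ Finset.Ioc k α, h k' α ∧
        ∑ k' ∈ Finset.Ioc k α, h k' α ≤ ∑ k' ∈ Finset.Ioc k (α + 1), h k' (α + 1)) ∧
      (MassMigration.Attractive P ↔ ∀ α m : ℕ, 1 ≤ α → 1 ≤ m → m ≤ α →
        0 ≤ ∑ j ∈ Finset.range m, (h (α - j) α - h (α + 1 - j) (α + 1)) ∧
        ∑ j ∈ Finset.range m, (h (α - j) α - h (α + 1 - j) (α + 1))
          ≤ h (α + 1 - m) (α + 1))) ∧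
    -- target process
    (∀ h : ℕ → ℕ → ℝ, M.IsTarget h →
      (MassMigration.Attractive P ↔ ∀ α β k : ℕ, 1 ≤ α →
        (h (α + 1) β ≤ h α β ∧ h α (β + 1) ≤ h α β) ∧
        ∑ k' ∈ Finset.Ioc (k + 1) α, h k' β ≤ ∑ k' ∈ Finset.Ioc k α, h k' (β + 1))) := by
  have hA := MassMigration.attractive_iff hP
  exact ⟨hA, fun h hh => ⟨hA.trans hh.tailCondition_iff,
    (hA.trans hh.tailCondition_iff).trans hh.condition_iff⟩,
    fun h hh => hA.trans hh.tailCondition_iff⟩
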